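/- **HDXs are parity samplers.** Let $X(\le d)$ be a pure simplicial complex on a finite vertex set $X(1)$: a downward-closed family of vertex sets (faces) of size at most $d$, each contained in a face of size $d$; $X(i)$ denotes the set of faces of size $i$. Let $\Pi_d$ be a probability measure on $X(d)$, and for $i<d$ let $\Pi_i$ be the distribution on $X(i)$ obtained by drawing $\mathfrak s^{(d)}\sim\Pi_d$ and repeatedly passing from $\mathfrak s^{(j)}$ to a uniformly random subset $\mathfrak s^{(j-1)}$ of size $j-1$. For $\mathfrak s\in X(i)$ with $i\le d-2$, let $X_{\mathfrak s}=\{\mathfrak t\setminus\mathfrak s:\mathfrak s\subseteq\mathfrak t\in X\}$ be the link of $\mathfrak s$ and let $G(X_{\mathfrak s})$ be the weighted graph with vertex set $X_{\mathfrak s}(1)$ and edge set $X_{\mathfrak s}(2)$, in which the edge $\{u,v\}$ has weight $\Pi_{i+2}(\mathfrak s\cup\{u,v\})$. The complex is a *$\gamma$-HDX* if for all $0\le i\le d-2$ and all $\mathfrak s\in X(i)$ the second largest singular value of the normalized adjacency matrix of $G(X_{\mathfrak s})$ (with zero rows and columns at vertices of weighted degree zero) is at most $\gamma$. The *direct sum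 lifting* on $X(k)$ sends $z\in\mathbb F_2^{X(1)}$ to $y\in\mathbb F_2^{X(k)}$ with $y_{\mathfrak s}=\sum_{i\in\mathfrak s}z_i$. The *bias* of a word $y\in\mathbb F_2^{X(i)}$ is $\left|\mathbb E_{\mathfrak s\sim\Pi_i}(-1)^{y_{\mathfrak s}}\right|$, and the lifting is a *$(\beta_0,\beta)$-parity sampler* if every $z\in\mathbb F_2^{X(1)}$ of bias at most $\beta_0$ is sent to a word of bias at most $\beta$. There is a universal constant $C>0$ such that the following holds. Let $0<\beta\le\beta_0<1$, let $0<\theta<\frac1{\beta_0}-1$, and let $k$ and $d$ be natural numbers with $$k\ \ge\ \log_{(1+\theta)\beta_0}(\beta/3),\qquad d\ \ge\ \max\left\{\frac{3k^2}{\beta},\ \frac{6}{\theta^2\beta_0^2\beta}\right\}.$$ If $X(\le d)$, with the measure $\Pi_d$, is a $\gamma$-HDX with $\gamma\le C/d^2$, then the direct sum lifting on $X(k)$ is a $(\beta_0,\beta)$-parity sampler. -/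

import Mathlib

/-- A pure simplicial complex `X(≤ d)` with ground set `X(1) = V`.  Faces are graded by their
cardinality, and the empty set is allowed as a face. -/
structure PureComplex (V : Type*) (d : ℕ) where
  faces : Finset (Finset V)
  down_closed : ∀ s ∈ faces, ∀ t ⊆ s, t ∈ faces
  vertex_mem : ∀ v : V, {v} ∈ faces
  card_le : ∀ s ∈ faces, s.card ≤ d
  pure : ∀ s ∈ faces, ∃ t ∈ faces, s ⊆ t ∧ t.card = d

namespace PureComplex

variable {V : Type*} {d : ℕ}

/-- `X(i)`: the faces of cardinality `i`. -/
def level (X : PureComplex V d) (i : ℕ) : Finset (Finset V) :=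
  X.faces.filter fun s => s.card = i

/-- The faces of the link complex `X_s = { t \ s | s ⊆ t ∈ X }`. -/
def link [DecidableEq V] (X : PureComplex V d) (s : Finset V) : Finset (Finset V) :=
  (X.faces.filter fun t => s ⊆ t).image fun t => t \ s

/-- The vertices `X_s(1)` of the link complex of `s`. -/
abbrev LinkVertex [DecidableEq V] (X : PureComplex V d) (s : Finset V) : Type _ :=
  {v : V // {v} ∈ X.link s}

end PureComplex

/-- A pure simplicial complex `X(≤ d)` together with a probability measure `Π_d` on `X(d)`. -/
structure MeasuredComplex (V : Type*) (d : ℕ) extends PureComplex V d where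
  top : Finset V → ℝ
  top_nonneg : ∀ s, 0 ≤ top s
  top_eq_zero : ∀ s, s ∉ toPureComplex.level d → top s = 0
  top_sum : ∑ s ∈ toPureComplex.level d, top s = 1

noncomputable section

/-- The weighted degree of a vertex in the weighted graph with edge weights `W`. -/
def weightedDegree {U : Type*} [Fintype U] (W : Matrix U U ℝ) (u : U) : ℝ :=
  ∑ v, W u v

/-- The normalized adjacency matrix `D^(-1/2) W D^(-1/2)` of the weighted graph with edge
weights `W`; it does not change if `W` is rescaled, and a vertex of degree zero has zero row
and column. -/
def normalizedAdjacency {U : Type*} [Fintype U] (W : Matrix U U ℝ) : Matrix U U ℝ :=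
  Matrix.of fun u v => W u v / (√(weightedDegree W u) * √(weightedDegree W v))

/-- `σ₂` of a weighted graph: the second largest singular value, counted with multiplicity, of
its normalized adjacency matrix.  (The sequence `LinearMap.singularValues` is decreasing and
starts at index `0`.) -/
def secondSingularValue {U : Type*} [Fintype U] [DecidableEq U] (W : Matrix U U ℝ) : ℝ :=
  (Matrix.toEuclideanLin (normalizedAdjacency W)).singularValues 1

/-- The bias `|E_{a ∼ p} (-1)^{y a}|` of a binary word `y` whose positions are distributed
according to the weights `p`. -/
def bias {A : Type*} [Fintype A] (p : A → ℝ) (y : A → ZMod 2) : ℝ :=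
  |∑ a, p a * (-1 : ℝ) ^ (y a).val|

namespace MeasuredComplex

variable {V : Type*} [DecidableEq V] {d : ℕ}

/-- The marginal distribution of `s^(d - j)` in the random chain `s^(d), s^(d-1), …` in which
`s^(d)` is drawn from `Π_d` and `s^(i-1)` is a uniformly random subset of `s^(i)` of size
`i - 1`. -/
def chainMarginal (X : MeasuredComplex V d) : ℕ → Finset V → ℝ
  | 0, s => X.top s
  | j + 1, t =>
      ∑ s ∈ X.level (d - j),
        if t ∈ s.powersetCard (d - (j + 1)) then
          X.chainMarginal j s / ((s.powersetCard (d - (j + 1))).card : ℝ)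
        else 0

/-- The probability measure `Π_i` on `X(i)`, for `i ≤ d`. -/
def levelMeasure (X : MeasuredComplex V d) (i : ℕ) (s : Finset V) : ℝ :=
  X.chainMarginal (d - i) s

/-- The skeleton `G(X_s)` of the link of `s`: its vertices are `X_s(1)`, its edges are `X_s(2)`,
and the weight of an edge `{u, v}` is `Π_{|s|+2}(s ∪ {u, v})`. -/
def skeletonWeight (X : MeasuredComplex V d) (s : Finset V) :
    Matrix (X.LinkVertex s) (X.LinkVertex s) ℝ :=
  Matrix.of fun u v =>
    if u ≠ v ∧ ({u.1, v.1} : Finset V) ∈ X.link s then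
      X.levelMeasure (s.card + 2) (s ∪ {u.1, v.1})
    else 0

/-- `X(≤ d)` is a `γ`-high-dimensional expander: for all `0 ≤ i ≤ d - 2` and all `s ∈ X(i)`, the
skeleton of the link of `s` has second largest singular value at most `γ`. -/
def IsHDX [Fintype V] (X : MeasuredComplex V d) (γ : ℝ) : Prop :=
  ∀ i : ℕ, i + 2 ≤ d → ∀ s ∈ X.level i, secondSingularValue (X.skeletonWeight s) ≤ γ

/-- The direct sum lifting on `X(k)`. -/
def directSum (X : MeasuredComplex V d) (k : ℕ) (z : V → ZMod 2) : X.level k → ZMod 2 :=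
  fun s => ∑ v ∈ s.1, z v

/-- A lifting from words on `X(1)` to words on `X(k)` is a `(β₀, β)`-parity sampler if it maps
words of bias at most `β₀` to words of bias at most `β`.  The positions of words on `X(i)` are
weighted by `Π_i`. -/
def IsParitySampler [Fintype V] (X : MeasuredComplex V d) (k : ℕ)
    (lift : (V → ZMod 2) → (X.level k → ZMod 2)) (β₀ β : ℝ) : Prop :=
  ∀ z : V → ZMod 2,
    bias (fun v : V => X.levelMeasure 1 {v}) z ≤ β₀ →
      bias (fun s : X.level k => X.levelMeasure k s.1) (lift z) ≤ β

end MeasuredComplex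

end

/-!
Draw a facet `s` and then a uniformly random `k`-subset `t` of `s`.  The `d` vertices of `s` are
almost sampled with replacement: the average of `∏ v ∈ t, f v` over `t` differs by at most
`k (k - 1) / d` from the `k`-th power of the average of `f = (-1) ^ z` over `s`.  The variance of
this facet average, over a random `s`, is at most `1 / d + σ₂`, where `σ₂` belongs to the
`1`-skeleton of the complex (the skeleton of the link of `∅`): the diagonal terms contribute
`1 / d`, and the pairs of distinct vertices of `s` are distributed as the edges of the skeleton.
By Chebyshev's inequality the facet average then exceeds `(1 + θ) β₀` in absolute value with small
probability, and otherwise its `k`-th power is at most `β / 3`.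
-/

open Finset Module
open scoped BigOperators InnerProductSpace

section Sampling

theorem abs_expect_le_one {V K : Type*} [Field K] [LinearOrder K] [IsStrictOrderedRing K]
    {s : Finset V} {f : V → K} (hf : ∀ v ∈ s, |f v| ≤ 1) :
    |𝔼 v ∈ s, f v| ≤ 1 := by
  obtain rfl | hs := s.eq_empty_or_nonempty
  · simp
  · exact (abs_expect_le s f).trans (expect_le hs hf)

variable {V : Type*}

theorem sum_powersetCard_succ_sum [DecidableEq V] {M : Type*} [AddCommMonoid M] (s : Finset V)
    (k : ℕ) (G : Finset V → V → M) :
    ∑ t ∈ s.powersetCard (k + 1), ∑ v ∈ t, G t v =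
      ∑ t ∈ s.powersetCard k, ∑ v ∈ s \ t, G (insert v t) v := by
  rw [sum_sigma', sum_sigma']
  refine sum_bij' (fun p _ ↦ ⟨p.1.erase p.2, p.2⟩) (fun p _ ↦ ⟨insert p.2 p.1, p.2⟩)
    ?_ ?_ ?_ ?_ ?_ <;> rintro ⟨t, v⟩ h <;>
    simp only [mem_sigma, mem_powersetCard, mem_sdiff] at h ⊢
  · exact ⟨⟨(erase_subset _ _).trans h.1.1, by rw [card_erase_of_mem h.2, h.1.2]; rfl⟩,
      h.1.1 h.2, notMem_erase _ _⟩
  · exact ⟨⟨insert_subset h.2.1 h.1.1, by rw [card_insert_of_notMem h.2.2, h.1.2]⟩,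
      mem_insert_self _ _⟩
  · simp only [insert_erase h.2]
  · simp only [erase_insert h.2.2]
  · simp only [insert_erase h.2]

theorem expect_powersetCard_succ_expect [DecidableEq V] {M : Type*} [AddCommMonoid M]
    [Module ℚ≥0 M] (s : Finset V) (k : ℕ) (G : Finset V → V → M) :
    𝔼 t ∈ s.powersetCard (k + 1), 𝔼 v ∈ t, G t v =
      𝔼 t ∈ s.powersetCard k, 𝔼 v ∈ s \ t, G (insert v t) v := by
  have inner_left : ∀ t ∈ s.powersetCard (k + 1),
      𝔼 v ∈ t, G t v = ((k + 1 : ℕ) : ℚ≥0)⁻¹ • ∑ v ∈ t, G t v := fun t ht ↦ by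
    rw [expect, (mem_powersetCard.1 ht).2]
  have inner_right : ∀ t ∈ s.powersetCard k, 𝔼 v ∈ s \ t, G (insert v t) v =
      ((#s - k : ℕ) : ℚ≥0)⁻¹ • ∑ v ∈ s \ t, G (insert v t) v := fun t ht ↦ by
    obtain ⟨hts, hcard⟩ := mem_powersetCard.1 ht
    rw [expect, card_sdiff_of_subset hts, hcard]
  have choose_identity :
      ((#s).choose (k + 1) * (k + 1 : ℕ) : ℚ≥0) = (#s).choose k * (#s - k : ℕ) := by
    exact_mod_cast Nat.choose_succ_right_eq #s k
  rw [expect_congr rfl inner_left, expect_congr rfl inner_right, expect, expect, ← smul_sum,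
    ← smul_sum, sum_powersetCard_succ_sum, smul_smul, smul_smul, card_powersetCard,
    card_powersetCard, ← mul_inv, ← mul_inv, choose_identity]

theorem expect_erase [DecidableEq V] {M : Type*} [AddCommMonoid M] [Module ℚ≥0 M] {s : Finset V}
    {k : ℕ} (hs : #s = k + 1) (F : Finset V → M) :
    𝔼 v ∈ s, F (s.erase v) = 𝔼 t ∈ s.powersetCard k, F t := by
  refine expect_nbij s.erase (fun v hv ↦ ?_) (fun _ _ ↦ rfl) (fun u hu v _ h ↦ ?_)
    fun t ht ↦ ?_
  · rw [mem_powersetCard, card_erase_of_mem hv, hs]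
    exact ⟨erase_subset _ _, rfl⟩
  · exact (erase_inj s hu).1 h
  · obtain ⟨hts, hcard⟩ := mem_powersetCard.1 ht
    obtain ⟨v, hv, rfl⟩ := exists_eq_insert_iff.2 ⟨hts, by rw [hcard, hs]⟩
    exact ⟨v, mem_insert_self v t, erase_insert hv⟩

theorem expect_powersetCard_succ_powersetCard {M : Type*} [AddCommMonoid M] [Module ℚ≥0 M]
    {s : Finset V} {k : ℕ} (hk : k < #s) (F : Finset V → M) :
    𝔼 t ∈ s.powersetCard (k + 1), 𝔼 r ∈ t.powersetCard k, F r =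
      𝔼 t ∈ s.powersetCard k, F t := by
  classical
  calc 𝔼 t ∈ s.powersetCard (k + 1), 𝔼 r ∈ t.powersetCard k, F r
      = 𝔼 t ∈ s.powersetCard (k + 1), 𝔼 v ∈ t, F (t.erase v) :=
        expect_congr rfl fun t ht ↦ (expect_erase (mem_powersetCard.1 ht).2 F).symm
    _ = 𝔼 t ∈ s.powersetCard k, 𝔼 v ∈ s \ t, F ((insert v t).erase v) :=
        expect_powersetCard_succ_expect s k fun t v ↦ F (t.erase v)
    _ = 𝔼 t ∈ s.powersetCard k, F t := by
        refine expect_congr rfl fun t ht ↦ ?_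
        obtain ⟨hts, hcard⟩ := mem_powersetCard.1 ht
        have nonempty : (s \ t).Nonempty := by
          rw [← card_pos, card_sdiff_of_subset hts]
          omega
        rw [expect_congr rfl fun v hv ↦ by rw [erase_insert (mem_sdiff.1 hv).2],
          expect_const nonempty]

variable {K : Type*} [Field K] [LinearOrder K] [IsStrictOrderedRing K]

theorem card_mul_expect_eq_of_subset [DecidableEq V] {s t : Finset V} (hts : t ⊆ s) (f : V → K) :
    #s * 𝔼 v ∈ s, f v = #(s \ t) * 𝔼 v ∈ s \ t, f v + #t * 𝔼 v ∈ t, f v := by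
  simp only [card_mul_expect, sum_sdiff hts]

theorem abs_expect_sdiff_sub_expect_le [DecidableEq V] {s t : Finset V} (hts : t ⊆ s) {f : V → K}
    (hf : ∀ v ∈ s, |f v| ≤ 1) :
    |𝔼 v ∈ s \ t, f v - 𝔼 v ∈ s, f v| ≤ 2 * #t / #s := by
  obtain rfl | hs := s.eq_empty_or_nonempty
  · simp
  have card_pos : (0 : K) < #s := by exact_mod_cast hs.card_pos
  have card_eq : (#s : K) = #(s \ t) + #t := by
    exact_mod_cast (card_sdiff_add_card_eq_card hts).symm
  have difference_eq : 𝔼 v ∈ s \ t, f v - 𝔼 v ∈ s, f v =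
      #t / #s * (𝔼 v ∈ s \ t, f v - 𝔼 v ∈ t, f v) := by
    field_simp
    linear_combination (𝔼 v ∈ s \ t, f v) * card_eq - card_mul_expect_eq_of_subset hts f
  have sdiff_le : |𝔼 v ∈ s \ t, f v| ≤ 1 := abs_expect_le_one fun v hv ↦ hf v (sdiff_subset hv)
  have subset_le : |𝔼 v ∈ t, f v| ≤ 1 := abs_expect_le_one fun v hv ↦ hf v (hts hv)
  calc |𝔼 v ∈ s \ t, f v - 𝔼 v ∈ s, f v|
      = #t / #s * |𝔼 v ∈ s \ t, f v - 𝔼 v ∈ t, f v| := by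
        rw [difference_eq, abs_mul, abs_of_nonneg (by positivity)]
    _ ≤ #t / #s * (1 + 1) := by
        gcongr
        exact (abs_sub _ _).trans (add_le_add sdiff_le subset_le)
    _ = 2 * #t / #s := by ring

theorem expect_powersetCard_succ_prod [DecidableEq V] (s : Finset V) (k : ℕ) (f : V → K) :
    𝔼 t ∈ s.powersetCard (k + 1), ∏ v ∈ t, f v =
      𝔼 t ∈ s.powersetCard k, (𝔼 v ∈ s \ t, f v) * ∏ v ∈ t, f v := by
  calc 𝔼 t ∈ s.powersetCard (k + 1), ∏ v ∈ t, f v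
      = 𝔼 t ∈ s.powersetCard (k + 1), 𝔼 _v ∈ t, ∏ u ∈ t, f u :=
        expect_congr rfl fun t ht ↦
          (expect_const (card_pos.1 (by simp [(mem_powersetCard.1 ht).2])) _).symm
    _ = 𝔼 t ∈ s.powersetCard k, 𝔼 v ∈ s \ t, ∏ u ∈ insert v t, f u :=
        expect_powersetCard_succ_expect s k fun t _ ↦ ∏ u ∈ t, f u
    _ = 𝔼 t ∈ s.powersetCard k, (𝔼 v ∈ s \ t, f v) * ∏ v ∈ t, f v :=
        expect_congr rfl fun t _ ↦ by
          rw [expect_mul]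
          exact expect_congr rfl fun v hv ↦ prod_insert (mem_sdiff.1 hv).2

theorem abs_expect_prod_powersetCard_sub_pow_le (s : Finset V) {f : V → K}
    (hf : ∀ v ∈ s, |f v| ≤ 1) (k : ℕ) :
    |𝔼 t ∈ s.powersetCard k, ∏ v ∈ t, f v - (𝔼 v ∈ s, f v) ^ k| ≤ k * (k - 1) / #s := by
  classical
  set a := 𝔼 v ∈ s, f v
  induction k with
  | zero => simp
  | succ k ih =>
    set E := 𝔼 t ∈ s.powersetCard k, ∏ v ∈ t, f v with hE
    set E' := 𝔼 t ∈ s.powersetCard (k + 1), ∏ v ∈ t, f v with hE'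
    have increment_eq : E' - a * E =
        𝔼 t ∈ s.powersetCard k, (𝔼 v ∈ s \ t, f v - a) * ∏ v ∈ t, f v := by
      simp only [hE', hE, expect_powersetCard_succ_prod, mul_expect, sub_mul, expect_sub_distrib]
    have term_le : ∀ t ∈ s.powersetCard k,
        |(𝔼 v ∈ s \ t, f v - a) * ∏ v ∈ t, f v| ≤ 2 * k / #s := fun t ht ↦ by
      obtain ⟨hts, hcard⟩ := mem_powersetCard.1 ht
      have prod_le : |∏ v ∈ t, f v| ≤ 1 := by
        rw [abs_prod]
        exact prod_le_one (fun _ _ ↦ abs_nonneg _) fun v hv ↦ hf v (hts hv)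
      rw [abs_mul, ← hcard]
      exact (mul_le_of_le_one_right (abs_nonneg _) prod_le).trans
        (abs_expect_sdiff_sub_expect_le hts hf)
    have increment_le : |E' - a * E| ≤ 2 * k / #s := by
      rw [increment_eq]
      obtain hempty | hne := (s.powersetCard k).eq_empty_or_nonempty
      · rw [hempty, expect_empty, abs_zero]
        positivity
      · exact (abs_expect_le _ _).trans (expect_le hne term_le)
    have previous_le : |a * (E - a ^ k)| ≤ k * (k - 1) / #s := by
      rw [abs_mul]
      exact (mul_le_of_le_one_left (abs_nonneg _) (abs_expect_le_one hf)).trans ih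
    calc |E' - a ^ (k + 1)| = |(E' - a * E) + a * (E - a ^ k)| := by congr 1; ring
      _ ≤ 2 * k / #s + k * (k - 1) / #s :=
        (abs_add_le _ _).trans (add_le_add increment_le previous_le)
      _ = (k + 1 : ℕ) * ((k + 1 : ℕ) - 1) / #s := by push_cast; ring

theorem sq_expect_eq_add_expect_erase [DecidableEq V] (s : Finset V) (f : V → K) :
    (𝔼 v ∈ s, f v) ^ 2 =
      1 / #s * 𝔼 v ∈ s, f v ^ 2 + (1 - 1 / #s) * 𝔼 u ∈ s, 𝔼 v ∈ s.erase u, f u * f v := by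
  have expect_eq : ∀ u ∈ s,
      𝔼 v ∈ s, f v = 1 / #s * f u + (1 - 1 / #s) * 𝔼 v ∈ s.erase u, f v := fun u hu ↦ by
    have card_ne : (#s : K) ≠ 0 := by exact_mod_cast (card_pos.2 ⟨u, hu⟩).ne'
    have split := card_mul_expect_eq_of_subset (singleton_subset_iff.2 hu) f
    rw [sdiff_singleton_eq_erase, cast_card_erase_of_mem hu, card_singleton,
      expect_singleton] at split
    field_simp
    linear_combination split
  calc (𝔼 v ∈ s, f v) ^ 2 = 𝔼 u ∈ s, f u * 𝔼 v ∈ s, f v := by rw [sq, expect_mul]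
    _ = 𝔼 u ∈ s, (1 / #s * f u ^ 2 + (1 - 1 / #s) * 𝔼 v ∈ s.erase u, f u * f v) :=
        expect_congr rfl fun u hu ↦ by rw [expect_eq u hu, ← mul_expect]; ring
    _ = _ := by rw [expect_add_distrib, ← mul_expect, ← mul_expect]

end Sampling

section SingularValues

variable {𝕜 E F : Type*} [RCLike 𝕜] [NormedAddCommGroup E] [InnerProductSpace 𝕜 E]
  [FiniteDimensional 𝕜 E] [NormedAddCommGroup F] [InnerProductSpace 𝕜 F] [FiniteDimensional 𝕜 F]

theorem norm_sq_apply_eq_sum_sq_singularValues (T : E →ₗ[𝕜] F) (x : E) :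
    ‖T x‖ ^ 2 = ∑ i : Fin (finrank 𝕜 E), T.singularValues i ^ 2 *
      ‖⟪T.isSymmetric_adjoint_comp_self.eigenvectorBasis rfl i, x⟫_𝕜‖ ^ 2 := by
  set b := T.isSymmetric_adjoint_comp_self.eigenvectorBasis rfl with hb
  have inner_eq (i : Fin (finrank 𝕜 E)) : ⟪(T.adjoint ∘ₗ T) x, b i⟫_𝕜 =
      (T.singularValues i ^ 2 : ℝ) * ⟪x, b i⟫_𝕜 := by
    rw [T.isSymmetric_adjoint_comp_self x (b i), hb,
      T.isSymmetric_adjoint_comp_self.apply_eigenvectorBasis, inner_smul_right,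
      T.sq_singularValues_fin rfl]
  rw [← inner_self_eq_norm_sq (𝕜 := 𝕜), ← LinearMap.adjoint_inner_left, ← LinearMap.comp_apply,
    ← b.sum_inner_mul_inner, map_sum]
  refine sum_congr rfl fun i _ ↦ ?_
  rw [inner_eq, mul_assoc, RCLike.re_ofReal_mul, ← inner_conj_symm x (b i), RCLike.conj_mul]
  norm_cast

theorem exists_forall_norm_apply_le_singularValues_mul (T : E →ₗ[𝕜] F) (n : ℕ) :
    ∃ e : Fin n → E, ∀ x, (∀ i, ⟪e i, x⟫_𝕜 = 0) → ‖T x‖ ≤ T.singularValues n * ‖x‖ := by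
  set b := T.isSymmetric_adjoint_comp_self.eigenvectorBasis rfl with hb
  refine ⟨fun i ↦ if h : i < finrank 𝕜 E then b ⟨i, h⟩ else 0, fun x hx ↦ ?_⟩
  refine le_of_sq_le_sq ?_ (mul_nonneg (T.singularValues_nonneg n) (norm_nonneg x))
  rw [mul_pow, norm_sq_apply_eq_sum_sq_singularValues, ← b.sum_sq_norm_inner_right x, mul_sum]
  refine sum_le_sum fun i _ ↦ ?_
  obtain hi | hi := lt_or_ge i.1 n
  · have inner_eq_zero : ⟪b i, x⟫_𝕜 = 0 := by simpa using hx ⟨i, hi⟩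
    simp [← hb, inner_eq_zero]
  · gcongr
    · exact T.singularValues_nonneg i
    · exact T.singularValues_antitone hi

theorem norm_apply_le_singularValues_one_mul_of_inner_eq_zero {T : E →ₗ[𝕜] F} {w g : E}
    (hw : T.singularValues 1 * ‖w‖ < ‖T w‖) (hwg : ⟪w, g⟫_𝕜 = 0) (hTwg : ⟪T w, T g⟫_𝕜 = 0) :
    ‖T g‖ ≤ T.singularValues 1 * ‖g‖ := by
  -- Some combination of `w` and `g` is orthogonal to the top singular vector `e 0`, so `T`
  -- stretches it by at most `σ`; since `T` stretches `w` by more, it stretches `g` by at most `σ`.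
  obtain ⟨e, he⟩ := exists_forall_norm_apply_le_singularValues_mul T 1
  have σ_nonneg := T.singularValues_nonneg 1
  set σ := T.singularValues 1
  have key (a b : 𝕜) (hab : ⟪e 0, a • w + b • g⟫_𝕜 = 0) :
      ‖a‖ ^ 2 * ‖T w‖ ^ 2 + ‖b‖ ^ 2 * ‖T g‖ ^ 2 ≤
        σ ^ 2 * (‖a‖ ^ 2 * ‖w‖ ^ 2 + ‖b‖ ^ 2 * ‖g‖ ^ 2) := by
    have h := pow_le_pow_left₀ (norm_nonneg _) (he _ (Fin.forall_fin_one.2 hab)) 2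
    rw [mul_pow, map_add, map_smul, map_smul, @norm_add_sq 𝕜, @norm_add_sq 𝕜] at h
    simpa [inner_smul_left, inner_smul_right, hwg, hTwg, norm_smul, mul_pow] using h
  have hw_sq : σ ^ 2 * ‖w‖ ^ 2 < ‖T w‖ ^ 2 := by
    rw [← mul_pow]
    exact pow_lt_pow_left₀ hw (by positivity) two_ne_zero
  have hew : ⟪e 0, w⟫_𝕜 ≠ 0 := fun h ↦ by
    have := key 1 0 (by simp [h])
    simp only [norm_one, norm_zero] at this
    linarith
  have combination := key (-⟪e 0, g⟫_𝕜) ⟪e 0, w⟫_𝕜 (by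
    rw [inner_add_right, inner_smul_right, inner_smul_right]; ring)
  rw [norm_neg] at combination
  refine le_of_sq_le_sq (le_of_mul_le_mul_left ?_ (by positivity : 0 < ‖⟪e 0, w⟫_𝕜‖ ^ 2))
    (by positivity)
  have := mul_le_mul_of_nonneg_left hw_sq.le (sq_nonneg ‖⟪e 0, g⟫_𝕜‖)
  linear_combination this + combination

end SingularValues

section WeightedGraph

variable {U : Type*} [Fintype U] {W : Matrix U U ℝ}

theorem weightedDegree_nonneg (hW : ∀ u v, 0 ≤ W u v) (u : U) : 0 ≤ weightedDegree W u :=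
  sum_nonneg fun v _ ↦ hW u v

theorem sum_weightedDegree_mul (W : Matrix U U ℝ) (f : U → ℝ) :
    ∑ u, weightedDegree W u * f u = ∑ u, ∑ v, W u v * f u := by
  simp only [weightedDegree, sum_mul]

theorem sqrt_weightedDegree_mul_normalizedAdjacency (hsymm : W.IsSymm) (hW : ∀ u v, 0 ≤ W u v)
    (u v : U) :
    √(weightedDegree W u) * normalizedAdjacency W u v * √(weightedDegree W v) = W u v := by
  have eq_zero {u : U} (v : U) (hu : √(weightedDegree W u) = 0) : W u v = 0 :=
    (sum_eq_zero_iff_of_nonneg fun v _ ↦ hW u v).1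
      ((Real.sqrt_eq_zero (weightedDegree_nonneg hW u)).1 hu) v (mem_univ v)
  rw [normalizedAdjacency, Matrix.of_apply]
  by_cases hu : √(weightedDegree W u) = 0
  · rw [eq_zero v hu, zero_div, mul_zero, zero_mul]
  by_cases hv : √(weightedDegree W v) = 0
  · rw [← hsymm.apply u v, eq_zero u hv, zero_div, mul_zero, zero_mul]
  field_simp

/-- The vector `D^(1/2) f`, where `D` is the diagonal matrix of weighted degrees.  It carries the
inner product of functions on the vertices weighted by degree to the Euclidean one. -/
noncomputable def sqrtDegreeMul (W : Matrix U U ℝ) (f : U → ℝ) : EuclideanSpace ℝ U :=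
  WithLp.toLp 2 fun u ↦ √(weightedDegree W u) * f u

theorem inner_sqrtDegreeMul (hW : ∀ u v, 0 ≤ W u v) (f g : U → ℝ) :
    ⟪sqrtDegreeMul W f, sqrtDegreeMul W g⟫_ℝ = ∑ u, weightedDegree W u * (f u * g u) := by
  simp only [sqrtDegreeMul, PiLp.inner_apply, RCLike.inner_apply, conj_trivial]
  refine sum_congr rfl fun u _ ↦ ?_
  linear_combination f u * g u * Real.mul_self_sqrt (weightedDegree_nonneg hW u)

theorem norm_sqrtDegreeMul_sq (hW : ∀ u v, 0 ≤ W u v) (f : U → ℝ) :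
    ‖sqrtDegreeMul W f‖ ^ 2 = ∑ u, weightedDegree W u * f u ^ 2 := by
  rw [← real_inner_self_eq_norm_sq, inner_sqrtDegreeMul hW]
  simp only [sq]

theorem sum_mul_le_sum_weightedDegree_mul_sq (hsymm : W.IsSymm) (hW : ∀ u v, 0 ≤ W u v)
    (f : U → ℝ) : ∑ u, ∑ v, W u v * (f u * f v) ≤ ∑ u, weightedDegree W u * f u ^ 2 := by
  have swap : ∑ u, ∑ v, W u v * f v ^ 2 = ∑ u, ∑ v, W u v * f u ^ 2 := by
    rw [sum_comm]
    simp only [hsymm.apply]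
  calc ∑ u, ∑ v, W u v * (f u * f v)
      ≤ ∑ u, ∑ v, (W u v * f u ^ 2 + W u v * f v ^ 2) / 2 :=
        sum_le_sum fun u _ ↦ sum_le_sum fun v _ ↦ by
          linear_combination 1 / 2 * mul_nonneg (hW u v) (sq_nonneg (f u - f v))
    _ = ∑ u, weightedDegree W u * f u ^ 2 := by
        simp only [← sum_div, sum_add_distrib, swap, sum_weightedDegree_mul]
        ring

variable [DecidableEq U]

theorem secondSingularValue_nonneg (W : Matrix U U ℝ) : 0 ≤ secondSingularValue W :=
  LinearMap.singularValues_nonneg _ _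

theorem inner_sqrtDegreeMul_toEuclideanLin (hsymm : W.IsSymm) (hW : ∀ u v, 0 ≤ W u v)
    (f g : U → ℝ) :
    ⟪sqrtDegreeMul W f, Matrix.toEuclideanLin (normalizedAdjacency W) (sqrtDegreeMul W g)⟫_ℝ =
      ∑ u, ∑ v, W u v * (f u * g v) := by
  simp only [sqrtDegreeMul, PiLp.inner_apply, Matrix.toLpLin_apply, Matrix.mulVec, dotProduct,
    RCLike.inner_apply, conj_trivial, sum_mul]
  refine sum_congr rfl fun u _ ↦ sum_congr rfl fun v _ ↦ ?_
  rw [← sqrt_weightedDegree_mul_normalizedAdjacency hsymm hW u v]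
  ring

theorem isSymmetric_toEuclideanLin_normalizedAdjacency (hsymm : W.IsSymm) :
    (Matrix.toEuclideanLin (normalizedAdjacency W)).IsSymmetric := by
  refine Matrix.isSymmetric_toEuclideanLin_iff.2 (Matrix.IsHermitian.ext fun u v ↦ ?_)
  simp [normalizedAdjacency, hsymm.apply u v, mul_comm]

theorem toEuclideanLin_normalizedAdjacency_sqrtDegreeMul_one (hsymm : W.IsSymm)
    (hW : ∀ u v, 0 ≤ W u v) :
    Matrix.toEuclideanLin (normalizedAdjacency W) (sqrtDegreeMul W 1) = sqrtDegreeMul W 1 := by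
  ext u
  simp only [sqrtDegreeMul, Matrix.toLpLin_apply, Matrix.mulVec, dotProduct, Pi.one_apply, mul_one]
  by_cases hu : √(weightedDegree W u) = 0
  · simp [normalizedAdjacency, hu]
  · apply mul_left_cancel₀ hu
    rw [Real.mul_self_sqrt (weightedDegree_nonneg hW u), mul_sum]
    exact sum_congr rfl fun v _ ↦ by
      rw [← mul_assoc, sqrt_weightedDegree_mul_normalizedAdjacency hsymm hW]

theorem sum_mul_le_secondSingularValue_mul (hsymm : W.IsSymm) (hW : ∀ u v, 0 ≤ W u v) {f : U → ℝ}
    (hf : ∑ u, weightedDegree W u * f u = 0) :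
    ∑ u, ∑ v, W u v * (f u * f v) ≤
      secondSingularValue W * ∑ u, weightedDegree W u * f u ^ 2 := by
  obtain hσ | hσ := le_or_gt 1 (secondSingularValue W)
  · refine (sum_mul_le_sum_weightedDegree_mul_sq hsymm hW f).trans
      (le_mul_of_one_le_left (sum_nonneg fun u _ ↦ ?_) hσ)
    exact mul_nonneg (weightedDegree_nonneg hW u) (sq_nonneg _)
  set T := Matrix.toEuclideanLin (normalizedAdjacency W) with hT
  set w := sqrtDegreeMul W 1 with hw
  set g := sqrtDegreeMul W f with hg
  have T_w : T w = w := toEuclideanLin_normalizedAdjacency_sqrtDegreeMul_one hsymm hW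
  have inner_w_g : ⟪w, g⟫_ℝ = 0 := by
    rw [inner_sqrtDegreeMul hW, ← hf]
    simp only [Pi.one_apply, one_mul]
  have inner_T : ⟪T w, T g⟫_ℝ = 0 := by
    rw [← isSymmetric_toEuclideanLin_normalizedAdjacency hsymm (T w) g, ← hT, T_w, T_w, inner_w_g]
  have norm_T_g : ‖T g‖ ≤ secondSingularValue W * ‖g‖ := by
    obtain hw0 | hw0 := eq_or_ne w 0
    · have degree_eq_zero (u : U) : √(weightedDegree W u) = 0 := by
        simpa [hw, sqrtDegreeMul] using congrArg (fun x : EuclideanSpace ℝ U ↦ x u) hw0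
      have g_eq_zero : g = 0 := by
        ext u
        simp [hg, sqrtDegreeMul, degree_eq_zero u]
      simp [g_eq_zero]
    · refine norm_apply_le_singularValues_one_mul_of_inner_eq_zero ?_ inner_w_g inner_T
      rw [T_w]
      exact mul_lt_of_lt_one_left (norm_pos_iff.2 hw0) hσ
  calc ∑ u, ∑ v, W u v * (f u * f v) = ⟪g, T g⟫_ℝ :=
        (inner_sqrtDegreeMul_toEuclideanLin hsymm hW f f).symm
    _ ≤ ‖g‖ * ‖T g‖ := real_inner_le_norm _ _
    _ ≤ ‖g‖ * (secondSingularValue W * ‖g‖) := by gcongr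
    _ = secondSingularValue W * ∑ u, weightedDegree W u * f u ^ 2 := by
        rw [← norm_sqrtDegreeMul_sq hW]
        ring

end WeightedGraph

theorem abs_pow_le_pow_add_sq_div_sq {a μ b δ : ℝ} (ha : |a| ≤ 1) (hμ : |μ| ≤ b) (hδ : 0 < δ)
    (k : ℕ) : |a| ^ k ≤ (b + δ) ^ k + (a - μ) ^ 2 / δ ^ 2 := by
  have b_nonneg : 0 ≤ b := (abs_nonneg μ).trans hμ
  obtain hclose | hfar := le_or_gt |a - μ| δ
  · have abs_a_le : |a| ≤ b + δ := by
      linarith [abs_sub_abs_le_abs_sub a μ]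
    exact (pow_le_pow_left₀ (abs_nonneg a) abs_a_le k).trans
      (le_add_of_nonneg_right (by positivity))
  · have one_le : 1 ≤ (a - μ) ^ 2 / δ ^ 2 := by
      rw [one_le_div (by positivity), ← sq_abs (a - μ)]
      gcongr
    exact (pow_le_one₀ (abs_nonneg a) ha).trans
      (one_le.trans (le_add_of_nonneg_left (by positivity)))

theorem neg_one_pow_val_sum {V : Type*} (t : Finset V) (z : V → ZMod 2) :
    (-1 : ℝ) ^ (∑ v ∈ t, z v).val = ∏ v ∈ t, (-1 : ℝ) ^ (z v).val :=
  map_prod (AddChar.zmodChar 2 (neg_one_sq : (-1 : ℝ) ^ 2 = 1)).toMonoidHom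
    (fun v ↦ Multiplicative.ofAdd (z v)) t

namespace MeasuredComplex

variable {V : Type*} {d : ℕ}

theorem card_of_mem_level (X : MeasuredComplex V d) {i : ℕ} {s : Finset V} (hs : s ∈ X.level i) :
    #s = i :=
  (mem_filter.1 hs).2

theorem mem_level_of_subset (X : MeasuredComplex V d) {i : ℕ} {s t : Finset V}
    (hs : s ∈ X.faces) (hts : t ⊆ s) (ht : #t = i) : t ∈ X.level i :=
  mem_filter.2 ⟨X.down_closed s hs t hts, ht⟩

theorem powersetCard_subset_level (X : MeasuredComplex V d) {s : Finset V} (hs : s ∈ X.faces)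
    (i : ℕ) : s.powersetCard i ⊆ X.level i := fun _ ht ↦
  X.mem_level_of_subset hs (mem_powersetCard.1 ht).1 (mem_powersetCard.1 ht).2

theorem empty_mem_level (X : MeasuredComplex V d) : ∅ ∈ X.level 0 := by
  obtain ⟨s, hs, -⟩ := exists_ne_zero_of_sum_ne_zero (X.top_sum ▸ one_ne_zero)
  exact X.mem_level_of_subset (mem_filter.1 hs).1 (empty_subset s) card_empty

variable [DecidableEq V]

theorem chainMarginal_nonneg (X : MeasuredComplex V d) (j : ℕ) (t : Finset V) :
    0 ≤ X.chainMarginal j t := by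
  induction j generalizing t with
  | zero => exact X.top_nonneg t
  | succ j ih =>
    refine sum_nonneg fun s _ ↦ ?_
    split_ifs
    · exact div_nonneg (ih s) (Nat.cast_nonneg _)
    · exact le_rfl

theorem levelMeasure_nonneg (X : MeasuredComplex V d) (i : ℕ) (t : Finset V) :
    0 ≤ X.levelMeasure i t :=
  X.chainMarginal_nonneg _ t

theorem levelMeasure_self (X : MeasuredComplex V d) (s : Finset V) :
    X.levelMeasure d s = X.top s := by
  rw [levelMeasure, Nat.sub_self, chainMarginal]

theorem levelMeasure_of_lt (X : MeasuredComplex V d) {i : ℕ} (hi : i < d) (t : Finset V) :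
    X.levelMeasure i t = ∑ s ∈ X.level (i + 1),
      if t ∈ s.powersetCard i then X.levelMeasure (i + 1) s / #(s.powersetCard i) else 0 := by
  have hsub : d - i = d - (i + 1) + 1 := by omega
  rw [levelMeasure, hsub, chainMarginal, ← hsub, Nat.sub_sub_self hi, Nat.sub_sub_self hi.le]
  rfl

theorem levelMeasure_eq_zero_of_notMem_level (X : MeasuredComplex V d) {i : ℕ} (hi : i ≤ d)
    {t : Finset V} (ht : t ∉ X.level i) : X.levelMeasure i t = 0 := by
  obtain rfl | hi := hi.eq_or_lt
  · rw [levelMeasure_self, X.top_eq_zero t ht]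
  · rw [levelMeasure_of_lt X hi]
    exact sum_eq_zero fun s hs ↦
      if_neg fun hts ↦ ht (X.powersetCard_subset_level (mem_filter.1 hs).1 i hts)

/-- The expectation of `F` over a random face of `X(i)` with distribution `Π_i`. -/
noncomputable def levelExpect (X : MeasuredComplex V d) (i : ℕ) (F : Finset V → ℝ) : ℝ :=
  ∑ s ∈ X.level i, X.levelMeasure i s * F s

theorem levelExpect_congr (X : MeasuredComplex V d) {i : ℕ} {F G : Finset V → ℝ}
    (h : ∀ s ∈ X.level i, F s = G s) : X.levelExpect i F = X.levelExpect i G :=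
  sum_congr rfl fun s hs ↦ by rw [h s hs]

theorem levelExpect_mono (X : MeasuredComplex V d) {i : ℕ} {F G : Finset V → ℝ}
    (h : ∀ s ∈ X.level i, F s ≤ G s) : X.levelExpect i F ≤ X.levelExpect i G :=
  sum_le_sum fun s hs ↦ mul_le_mul_of_nonneg_left (h s hs) (X.levelMeasure_nonneg i s)

theorem abs_levelExpect_le (X : MeasuredComplex V d) (i : ℕ) (F : Finset V → ℝ) :
    |X.levelExpect i F| ≤ X.levelExpect i fun s ↦ |F s| :=
  (abs_sum_le_sum_abs _ _).trans_eq <| sum_congr rfl fun s _ ↦ by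
    rw [abs_mul, abs_of_nonneg (X.levelMeasure_nonneg i s)]

theorem levelExpect_add (X : MeasuredComplex V d) (i : ℕ) (F G : Finset V → ℝ) :
    X.levelExpect i (fun s ↦ F s + G s) = X.levelExpect i F + X.levelExpect i G := by
  simp only [levelExpect, mul_add, sum_add_distrib]

theorem levelExpect_const_mul (X : MeasuredComplex V d) (i : ℕ) (c : ℝ) (F : Finset V → ℝ) :
    X.levelExpect i (fun s ↦ c * F s) = c * X.levelExpect i F := by
  simp only [levelExpect, mul_sum, mul_left_comm]

theorem levelExpect_sum (X : MeasuredComplex V d) (i : ℕ) {ι : Type*} (A : Finset ι)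
    (F : ι → Finset V → ℝ) :
    X.levelExpect i (fun s ↦ ∑ a ∈ A, F a s) = ∑ a ∈ A, X.levelExpect i (F a) := by
  simp only [levelExpect, mul_sum]
  exact sum_comm

theorem levelExpect_top_const (X : MeasuredComplex V d) (c : ℝ) :
    X.levelExpect d (fun _ ↦ c) = c := by
  simp only [levelExpect, levelMeasure_self, ← sum_mul, X.top_sum, one_mul]

theorem levelExpect_of_lt (X : MeasuredComplex V d) {i : ℕ} (hi : i < d) (F : Finset V → ℝ) :
    X.levelExpect i F = X.levelExpect (i + 1) fun s ↦ 𝔼 t ∈ s.powersetCard i, F t := by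
  simp only [levelExpect, X.levelMeasure_of_lt hi, sum_mul]
  rw [sum_comm]
  refine sum_congr rfl fun s hs ↦ ?_
  simp only [ite_mul, zero_mul, sum_ite_mem]
  rw [inter_eq_right.2 (X.powersetCard_subset_level (mem_filter.1 hs).1 i), ← mul_sum,
    expect_eq_sum_div_card]
  ring

theorem levelExpect_of_le (X : MeasuredComplex V d) {i : ℕ} (hi : i ≤ d) (F : Finset V → ℝ) :
    X.levelExpect i F = X.levelExpect d fun s ↦ 𝔼 t ∈ s.powersetCard i, F t := by
  have powersetCard_card {s : Finset V} {j : ℕ} (hs : s ∈ X.level j) : s.powersetCard j = {s} := by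
    rw [← X.card_of_mem_level hs, powersetCard_self]
  induction hi using Nat.decreasingInduction generalizing F with
  | self => exact X.levelExpect_congr fun s hs ↦ by rw [powersetCard_card hs, expect_singleton]
  | of_succ i hi ih =>
    rw [X.levelExpect_of_lt hi, ih]
    exact X.levelExpect_congr fun s hs ↦
      expect_powersetCard_succ_powersetCard (by rwa [X.card_of_mem_level hs]) F

theorem levelMeasure_eq_levelExpect (X : MeasuredComplex V d) {i : ℕ} (hi : i ≤ d)
    {t : Finset V} (ht : #t = i) :
    X.levelMeasure i t = X.levelExpect d fun s ↦ if t ⊆ s then ((d.choose i : ℕ) : ℝ)⁻¹ else 0 := by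
  calc X.levelMeasure i t = X.levelExpect i fun r ↦ if t = r then 1 else 0 := by
        simp only [levelExpect, mul_ite, mul_one, mul_zero, sum_ite_eq]
        split_ifs with h
        · rfl
        · exact X.levelMeasure_eq_zero_of_notMem_level hi h
    _ = X.levelExpect d fun s ↦ 𝔼 r ∈ s.powersetCard i, if t = r then 1 else 0 :=
        X.levelExpect_of_le hi _
    _ = _ := X.levelExpect_congr fun s hs ↦ by
        simp only [expect_eq_sum_div_card, sum_ite_eq, mem_powersetCard, ht, and_true,
          card_powersetCard, X.card_of_mem_level hs, ite_div, one_div, zero_div]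

theorem singleton_mem_link_empty (X : MeasuredComplex V d) (v : V) : {v} ∈ X.link ∅ :=
  mem_image.2 ⟨{v}, mem_filter.2 ⟨X.vertex_mem v, empty_subset _⟩, sdiff_empty⟩

theorem skeletonWeight_empty_apply (X : MeasuredComplex V d) (hd : 2 ≤ d)
    (u v : X.LinkVertex ∅) : X.skeletonWeight ∅ u v = X.levelMeasure 2 {u.1, v.1} := by
  rw [skeletonWeight, Matrix.of_apply, card_empty, empty_union]
  refine ite_eq_left_iff.2 fun h ↦ .symm <|
    X.levelMeasure_eq_zero_of_notMem_level hd fun hlevel ↦ h ?_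
  obtain ⟨hface, hcard⟩ := mem_filter.1 hlevel
  refine ⟨fun huv ↦ ?_, mem_image.2 ⟨_, mem_filter.2 ⟨hface, empty_subset _⟩, sdiff_empty⟩⟩
  simp [huv] at hcard

theorem isSymm_skeletonWeight_empty (X : MeasuredComplex V d) (hd : 2 ≤ d) :
    (X.skeletonWeight ∅).IsSymm :=
  Matrix.IsSymm.ext fun u v ↦ by
    rw [skeletonWeight_empty_apply X hd, skeletonWeight_empty_apply X hd, pair_comm]

theorem skeletonWeight_nonneg (X : MeasuredComplex V d) (s : Finset V) (u v : X.LinkVertex s) :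
    0 ≤ X.skeletonWeight s u v := by
  rw [skeletonWeight, Matrix.of_apply]
  split_ifs
  · exact X.levelMeasure_nonneg _ _
  · exact le_rfl

theorem levelMeasure_two_pair (X : MeasuredComplex V d) (hd : 2 ≤ d) (u v : V) :
    X.levelMeasure 2 {u, v} = X.levelExpect d fun s ↦
      if u ∈ s then if v ∈ s.erase u then ((d.choose 2 : ℕ) : ℝ)⁻¹ else 0 else 0 := by
  obtain rfl | huv := eq_or_ne u v
  · rw [X.levelMeasure_eq_zero_of_notMem_level hd fun h ↦ by simpa using X.card_of_mem_level h]
    simp [levelExpect]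
  · rw [X.levelMeasure_eq_levelExpect hd (card_pair huv)]
    simp only [insert_subset_iff, singleton_subset_iff, mem_erase, huv.symm, ne_eq,
      not_false_eq_true, true_and, ite_and]

theorem bias_directSum (X : MeasuredComplex V d) (k : ℕ) (z : V → ZMod 2) :
    bias (fun s : X.level k ↦ X.levelMeasure k s.1) (X.directSum k z) =
      |X.levelExpect k fun t ↦ ∏ v ∈ t, (-1 : ℝ) ^ (z v).val| := by
  simp only [bias, directSum, neg_one_pow_val_sum]
  rw [sum_coe_sort (X.level k) fun t ↦ X.levelMeasure k t * ∏ v ∈ t, (-1 : ℝ) ^ (z v).val,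
    levelExpect]

variable [Fintype V]

theorem sum_levelMeasure_singleton_mul (X : MeasuredComplex V d) (hd : 1 ≤ d) (F : V → ℝ) :
    ∑ v, X.levelMeasure 1 {v} * F v = X.levelExpect d fun s ↦ 𝔼 v ∈ s, F v := by
  simp only [X.levelMeasure_eq_levelExpect hd (card_singleton _), mul_comm _ (F _),
    ← levelExpect_const_mul, ← levelExpect_sum]
  refine X.levelExpect_congr fun s hs ↦ ?_
  simp only [Nat.choose_one_right, singleton_subset_iff, mul_ite, mul_zero, sum_ite_mem,
    univ_inter, expect_eq_sum_div_card, X.card_of_mem_level hs, sum_mul, div_eq_mul_inv]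

theorem sum_skeletonWeight_empty_mul (X : MeasuredComplex V d) (hd : 2 ≤ d) (G : V → V → ℝ) :
    ∑ u, ∑ v, X.skeletonWeight ∅ u v * G u v =
      2 * X.levelExpect d fun s ↦ 𝔼 u ∈ s, 𝔼 v ∈ s.erase u, G u v := by
  have sum_linkVertex (F : V → ℝ) : ∑ u : X.LinkVertex ∅, F u = ∑ u, F u :=
    (Equiv.subtypeUnivEquiv X.singleton_mem_link_empty).sum_comp F
  have facet_term : ∀ s ∈ X.level d,
      ∑ u ∈ s, ∑ v ∈ s.erase u, G u v * ((d.choose 2 : ℕ) : ℝ)⁻¹ =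
        2 * 𝔼 u ∈ s, 𝔼 v ∈ s.erase u, G u v := fun s hs ↦ by
    have expect_erase_eq : ∀ u ∈ s, 𝔼 v ∈ s.erase u, G u v = (∑ v ∈ s.erase u, G u v) / (d - 1) :=
      fun u hu ↦ by
        rw [expect_eq_sum_div_card, cast_card_erase_of_mem hu, X.card_of_mem_level hs]
    rw [expect_congr rfl expect_erase_eq, expect_eq_sum_div_card, X.card_of_mem_level hs]
    simp only [← sum_mul, Nat.cast_choose_two, div_eq_mul_inv, mul_inv]
    ring
  calc ∑ u, ∑ v, X.skeletonWeight ∅ u v * G u v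
      = ∑ u : V, ∑ v : V, X.levelMeasure 2 {u, v} * G u v := by
        simp only [X.skeletonWeight_empty_apply hd]
        rw [← sum_linkVertex]
        exact sum_congr rfl fun u _ ↦ sum_linkVertex fun v ↦ X.levelMeasure 2 {u.1, v} * G u v
    _ = X.levelExpect d fun s ↦ ∑ u ∈ s, ∑ v ∈ s.erase u, G u v * ((d.choose 2 : ℕ) : ℝ)⁻¹ := by
        simp only [X.levelMeasure_two_pair hd, mul_comm _ (G _ _), ← levelExpect_const_mul,
          ← levelExpect_sum, mul_ite, mul_zero, sum_ite_irrel, sum_const_zero, sum_ite_mem,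
          univ_inter]
    _ = 2 * X.levelExpect d fun s ↦ 𝔼 u ∈ s, 𝔼 v ∈ s.erase u, G u v := by
        rw [← levelExpect_const_mul]
        exact X.levelExpect_congr facet_term

theorem sum_weightedDegree_skeletonWeight_empty_mul (X : MeasuredComplex V d) (hd : 2 ≤ d)
    (F : V → ℝ) :
    ∑ u : X.LinkVertex ∅, weightedDegree (X.skeletonWeight ∅) u * F u =
      2 * X.levelExpect d fun s ↦ 𝔼 v ∈ s, F v := by
  rw [sum_weightedDegree_mul, X.sum_skeletonWeight_empty_mul hd fun u _ ↦ F u]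
  congr 1
  refine X.levelExpect_congr fun s hs ↦ expect_congr rfl fun u hu ↦ expect_const ?_ _
  rw [← card_pos, card_erase_of_mem hu, X.card_of_mem_level hs]
  omega

theorem levelExpect_sq_expect_le (X : MeasuredComplex V d) (hd : 2 ≤ d) {f : V → ℝ}
    (hf : X.levelExpect d (fun s ↦ 𝔼 v ∈ s, f v) = 0) :
    X.levelExpect d (fun s ↦ (𝔼 v ∈ s, f v) ^ 2) ≤
      (1 / d + secondSingularValue (X.skeletonWeight ∅)) *
        X.levelExpect d fun s ↦ 𝔼 v ∈ s, f v ^ 2 := by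
  set σ := secondSingularValue (X.skeletonWeight ∅)
  set Q := X.levelExpect d fun s ↦ 𝔼 v ∈ s, f v ^ 2
  set P := X.levelExpect d fun s ↦ 𝔼 u ∈ s, 𝔼 v ∈ s.erase u, f u * f v
  have d_inv_le_one : 1 / (d : ℝ) ≤ 1 := by
    rw [one_div]
    exact Nat.cast_inv_le_one d
  have Q_nonneg : 0 ≤ Q := sum_nonneg fun s _ ↦
    mul_nonneg (X.levelMeasure_nonneg d s) (expect_nonneg fun v _ ↦ sq_nonneg (f v))
  have P_le : P ≤ σ * Q := by
    have h := sum_mul_le_secondSingularValue_mul (X.isSymm_skeletonWeight_empty hd)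
      (X.skeletonWeight_nonneg ∅) (f := fun u ↦ f u.1)
      (by rw [X.sum_weightedDegree_skeletonWeight_empty_mul hd, hf, mul_zero])
    rw [X.sum_skeletonWeight_empty_mul hd fun u v ↦ f u * f v,
      X.sum_weightedDegree_skeletonWeight_empty_mul hd fun u ↦ f u ^ 2] at h
    linarith
  calc X.levelExpect d (fun s ↦ (𝔼 v ∈ s, f v) ^ 2)
      = 1 / d * Q + (1 - 1 / d) * P := by
        rw [← levelExpect_const_mul, ← levelExpect_const_mul, ← levelExpect_add]
        exact X.levelExpect_congr fun s hs ↦ by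
          rw [sq_expect_eq_add_expect_erase, X.card_of_mem_level hs]
    _ ≤ 1 / d * Q + σ * Q := by
        refine add_le_add le_rfl ((mul_le_mul_of_nonneg_left P_le
          (sub_nonneg.2 d_inv_le_one)).trans (mul_le_of_le_one_left ?_ ?_))
        · exact mul_nonneg (secondSingularValue_nonneg _) Q_nonneg
        · exact sub_le_self _ (by positivity)
    _ = (1 / d + σ) * Q := by ring

theorem levelExpect_sq_expect_sub_le (X : MeasuredComplex V d) (hd : 2 ≤ d) {f : V → ℝ}
    (hf : ∀ v, |f v| ≤ 1) :
    X.levelExpect d (fun s ↦ (𝔼 v ∈ s, f v - X.levelExpect d fun s ↦ 𝔼 v ∈ s, f v) ^ 2) ≤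
      1 / d + secondSingularValue (X.skeletonWeight ∅) := by
  set μ := X.levelExpect d fun s ↦ 𝔼 v ∈ s, f v with hμ
  have face_nonempty {s : Finset V} (hs : s ∈ X.level d) : s.Nonempty :=
    card_pos.1 (by rw [X.card_of_mem_level hs]; omega)
  have expect_sub : ∀ s ∈ X.level d, 𝔼 v ∈ s, (f v - μ) = 𝔼 v ∈ s, f v + -μ := fun s hs ↦ by
    rw [expect_sub_distrib, expect_const (face_nonempty hs), sub_eq_add_neg]
  have centered : X.levelExpect d (fun s ↦ 𝔼 v ∈ s, (f v - μ)) = 0 := by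
    rw [X.levelExpect_congr expect_sub, levelExpect_add, levelExpect_top_const, ← hμ,
      add_neg_cancel]
  have variance_le : X.levelExpect d (fun s ↦ 𝔼 v ∈ s, (f v - μ) ^ 2) ≤ 1 := by
    calc X.levelExpect d (fun s ↦ 𝔼 v ∈ s, (f v - μ) ^ 2)
        ≤ X.levelExpect d (fun s ↦ (1 + μ ^ 2) + -2 * μ * 𝔼 v ∈ s, f v) :=
          X.levelExpect_mono fun s hs ↦ by
            rw [mul_expect, ← expect_const (face_nonempty hs) (1 + μ ^ 2), ← expect_add_distrib]
            exact expect_le_expect fun v _ ↦ by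
              have := (sq_le_one_iff_abs_le_one (f v)).2 (hf v)
              linarith
      _ = 1 - μ ^ 2 := by
          rw [levelExpect_add, levelExpect_top_const, levelExpect_const_mul, ← hμ]
          ring
      _ ≤ 1 := sub_le_self _ (sq_nonneg μ)
  calc X.levelExpect d (fun s ↦ (𝔼 v ∈ s, f v - μ) ^ 2)
      = X.levelExpect d (fun s ↦ (𝔼 v ∈ s, (f v - μ)) ^ 2) :=
        X.levelExpect_congr fun s hs ↦ by rw [expect_sub s hs, sub_eq_add_neg]
    _ ≤ (1 / d + secondSingularValue (X.skeletonWeight ∅)) *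
          X.levelExpect d fun s ↦ 𝔼 v ∈ s, (f v - μ) ^ 2 := X.levelExpect_sq_expect_le hd centered
    _ ≤ _ := mul_le_of_le_one_right
        (add_nonneg (by positivity) (secondSingularValue_nonneg _)) variance_le

theorem abs_levelExpect_prod_le (X : MeasuredComplex V d) {k : ℕ} (hd : 2 ≤ d) (hk : k ≤ d)
    {f : V → ℝ} (hf : ∀ v, |f v| ≤ 1) {b δ : ℝ} (hb : |∑ v, X.levelMeasure 1 {v} * f v| ≤ b)
    (hδ : 0 < δ) :
    |X.levelExpect k fun t ↦ ∏ v ∈ t, f v| ≤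
      k * (k - 1) / d + ((b + δ) ^ k +
        (1 / d + secondSingularValue (X.skeletonWeight ∅)) / δ ^ 2) := by
  rw [X.sum_levelMeasure_singleton_mul (by omega)] at hb
  set μ := X.levelExpect d fun s ↦ 𝔼 v ∈ s, f v
  have pointwise : ∀ s ∈ X.level d, |𝔼 t ∈ s.powersetCard k, ∏ v ∈ t, f v| ≤
      k * (k - 1) / d + ((b + δ) ^ k + 1 / δ ^ 2 * (𝔼 v ∈ s, f v - μ) ^ 2) := fun s hs ↦ by
    have sampling := abs_expect_prod_powersetCard_sub_pow_le s (fun v _ ↦ hf v) k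
    have power := abs_pow_le_pow_add_sq_div_sq (abs_expect_le_one fun v (_ : v ∈ s) ↦ hf v) hb hδ k
    rw [X.card_of_mem_level hs] at sampling
    rw [← abs_pow] at power
    have := abs_sub_abs_le_abs_sub (𝔼 t ∈ s.powersetCard k, ∏ v ∈ t, f v) ((𝔼 v ∈ s, f v) ^ k)
    rw [one_div_mul_eq_div]
    linarith
  rw [X.levelExpect_of_le hk]
  refine (X.abs_levelExpect_le d _).trans ((X.levelExpect_mono pointwise).trans ?_)
  rw [levelExpect_add, levelExpect_add, levelExpect_top_const, levelExpect_top_const,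
    levelExpect_const_mul, one_div_mul_eq_div]
  gcongr
  exact X.levelExpect_sq_expect_sub_le hd hf

theorem IsHDX.secondSingularValue_skeletonWeight_empty_le {X : MeasuredComplex V d} {γ : ℝ}
    (hX : X.IsHDX γ) (hd : 2 ≤ d) : secondSingularValue (X.skeletonWeight ∅) ≤ γ :=
  hX 0 (by omega) ∅ X.empty_mem_level

end MeasuredComplex

section Parameters

variable {β₀ β θ : ℝ} {k d : ℕ}

theorem pow_le_of_logb_le {x c : ℝ} (hx : 0 < x) (hx1 : x < 1) (hc : 0 < c)
    (hk : Real.logb x c ≤ k) : x ^ k ≤ c := by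
  rwa [Real.logb_le_iff_le_rpow_of_base_lt_one hx hx1 hc, Real.rpow_natCast] at hk

theorem mul_sub_one_div_le (hβ : 0 < β) (hd : 3 * (k : ℝ) ^ 2 / β ≤ d) :
    (k * (k - 1) / d : ℝ) ≤ β / 3 := by
  rw [div_le_iff₀ hβ] at hd
  refine div_le_of_le_mul₀ d.cast_nonneg (by positivity) ?_
  linarith [Nat.cast_nonneg (α := ℝ) k]

theorem le_of_three_mul_sq_div_le (hβ : 0 < β) (hβ1 : β ≤ 1) (hd : 3 * (k : ℝ) ^ 2 / β ≤ d) :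
    k ≤ d := by
  rw [div_le_iff₀ hβ] at hd
  have sq_le : k ^ 2 ≤ d := by
    have : (k : ℝ) ^ 2 ≤ d := by
      linarith [mul_le_of_le_one_right d.cast_nonneg hβ1, sq_nonneg (k : ℝ)]
    exact_mod_cast this
  exact (Nat.le_self_pow two_ne_zero k).trans sq_le

theorem one_add_mul_lt_one (hβ₀ : 0 < β₀) (hθβ₀ : θ < 1 / β₀ - 1) : (1 + θ) * β₀ < 1 := by
  rw [← lt_div_iff₀ hβ₀]
  linarith

theorem six_le_of_six_div_le (hβ₀ : 0 < β₀) (hβ : 0 < β) (hβ1 : β ≤ 1) (hθ : 0 < θ)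
    (hθβ₀ : θ < 1 / β₀ - 1) (hd : 6 / (θ ^ 2 * β₀ ^ 2 * β) ≤ d) : 6 ≤ d := by
  have θβ₀_le_one : θ * β₀ ≤ 1 := by linarith [one_add_mul_lt_one hβ₀ hθβ₀]
  have denominator_le_one : θ ^ 2 * β₀ ^ 2 * β ≤ 1 := by
    rw [← mul_pow]
    exact mul_le_one₀ (pow_le_one₀ (by positivity) θβ₀_le_one) hβ.le hβ1
  have : (6 : ℝ) ≤ d := (le_div_self (by norm_num) (by positivity) denominator_le_one).trans hd
  exact_mod_cast this

end Parameters

theorem mainTheorem7_general {β₀ β θ : ℝ} {k d : ℕ} (hβ₀ : 0 < β₀) (hβ : 0 < β) (hβ1 : β ≤ 1)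
    (hθ : 0 < θ) (hθβ₀ : θ < 1 / β₀ - 1) (hk : Real.logb ((1 + θ) * β₀) (β / 3) ≤ k)
    (hd : max (3 * (k : ℝ) ^ 2 / β) (6 / (θ ^ 2 * β₀ ^ 2 * β)) ≤ (d : ℝ))
    {V : Type*} [Fintype V] [DecidableEq V] (X : MeasuredComplex V d)
    (hσ : secondSingularValue (X.skeletonWeight ∅) ≤ 1 / d) :
    X.IsParitySampler k (X.directSum k) β₀ β := by
  obtain ⟨hd_sampling, hd_variance⟩ := max_le_iff.1 hd
  have hd6 := six_le_of_six_div_le hβ₀ hβ hβ1 hθ hθβ₀ hd_variance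
  have variance_term : (1 / d + secondSingularValue (X.skeletonWeight ∅)) / (θ * β₀) ^ 2 ≤
      β / 3 := by
    rw [div_le_iff₀ (by positivity)] at hd_variance ⊢
    have : 2 / (d : ℝ) ≤ β / 3 * (θ * β₀) ^ 2 := by
      rw [div_le_iff₀ (by positivity)]
      linarith
    linarith [add_div (1 : ℝ) 1 d]
  have power_term : (β₀ + θ * β₀) ^ k ≤ β / 3 := by
    rw [← one_add_mul]
    exact pow_le_of_logb_le (by positivity) (one_add_mul_lt_one hβ₀ hθβ₀) (by positivity) hk
  intro z hz
  rw [X.bias_directSum]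
  refine (X.abs_levelExpect_prod_le (by omega) (le_of_three_mul_sq_div_le hβ hβ1 hd_sampling)
    (fun v ↦ by simp) hz (mul_pos hθ hβ₀)).trans ?_
  linarith [mul_sub_one_div_le hβ hd_sampling]

theorem mainTheorem7 :
    ∃ C : ℝ, 0 < C ∧
      ∀ (β₀ β θ γ : ℝ) (k d : ℕ),
        0 < β → β ≤ β₀ → β₀ < 1 →
        0 < θ → θ < 1 / β₀ - 1 →
        Real.logb ((1 + θ) * β₀) (β / 3) ≤ (k : ℝ) →
        max (3 * (k : ℝ) ^ 2 / β) (6 / (θ ^ 2 * β₀ ^ 2 * β)) ≤ (d : ℝ) →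
        γ ≤ C / (d : ℝ) ^ 2 →
        ∀ (V : Type*) [Fintype V] [DecidableEq V] (X : MeasuredComplex V d),
          X.IsHDX γ → X.IsParitySampler k (X.directSum k) β₀ β := by
  refine ⟨1, one_pos, fun β₀ β θ γ k d hβ hββ₀ hβ₀1 hθ hθβ₀ hk hd hγ V _ _ X hX ↦ ?_⟩
  have hβ₀ := hβ.trans_le hββ₀
  have hβ1 := hββ₀.trans hβ₀1.le
  have hd6 := six_le_of_six_div_le hβ₀ hβ hβ1 hθ hθβ₀ ((le_max_right _ _).trans hd)
  have one_le_d : (1 : ℝ) ≤ d := by exact_mod_cast (by omega : 1 ≤ d)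
  have hγd := hγ.trans
    (one_div_le_one_div_of_le (by positivity) (le_self_pow₀ one_le_d two_ne_zero))
  exact mainTheorem7_general hβ₀ hβ hβ1 hθ hθβ₀ hk hd X
    ((hX.secondSingularValue_skeletonWeight_empty_le (by omega)).trans hγd)
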